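/- Let $a,b,r,s$ be integers with $a\ge 1$, $b\ge 1$, $0\le r\le a-1$ and $0\le s\le b-1$, and let $\Psi:[1,\infty)\to(0,\infty)$ be a non-increasing continuous function. Let $\mathcal{K}(\Psi)$ be the set of all real numbers $\xi$ such that $$\left|\xi-\frac{am+r}{bn+s}\right|<\Psi(bn+s)$$ for infinitely many pairs of integers $(m,n)$ with $bn+s\ge 1$, and let $\mathcal{K}'(\Psi)$ be the set of all real numbers $\xi$ such that this inequality holds for infinitely many pairs of integers $(m,n)$ with $bn+s\ge 1$ that satisfy in addition $\gcd(am+r,bn+s)=\gcd(a,b,r,s)$. Let $\lambda$ denote the Lebesgue measure on $\mathbb{R}$. If $\sum_{n=1}^{\infty}n\Psi(bn+s)<\infty$, then $\lambda(\mathcal{K}(\Psi))=\lambda(\mathcal{K}'(\Psi))=0$. If $\sum_{n=1}^{\infty}n\Psi(bn+s)=\infty$, then both sets have full measure, that is, $\lambda(\mathbb{R}\setminus\mathcal{K}(\Psi))=\lambda(\mathbb{R}\setminus\mathcal{K}'(\Psi))=0$. -/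

import Mathlib

open MeasureTheory

/-- The real numbers `ξ` such that `|ξ - (a m + r) / (b n + s)| < Ψ (b n + s)` holds for infinitely
many pairs of integers `(m, n)` with denominator `b n + s ≥ 1` (as `Ψ` is a function on `[1, ∞)`). -/
def approxSet (a b r s : ℤ) (Ψ : ℝ → ℝ) : Set ℝ :=
  {ξ : ℝ | {p : ℤ × ℤ | 1 ≤ b * p.2 + s ∧
    |ξ - ((a * p.1 + r : ℤ) : ℝ) / ((b * p.2 + s : ℤ) : ℝ)|
      < Ψ ((b * p.2 + s : ℤ) : ℝ)}.Infinite}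

/-- The same set as `approxSet`, where only the pairs `(m, n)` such that
`gcd (a m + r, b n + s) = gcd (a, b, r, s)` are counted. -/
def approxSetGcd (a b r s : ℤ) (Ψ : ℝ → ℝ) : Set ℝ :=
  {ξ : ℝ | {p : ℤ × ℤ | 1 ≤ b * p.2 + s ∧
    |ξ - ((a * p.1 + r : ℤ) : ℝ) / ((b * p.2 + s : ℤ) : ℝ)|
      < Ψ ((b * p.2 + s : ℤ) : ℝ) ∧
    Int.gcd (a * p.1 + r) (b * p.2 + s)
      = Nat.gcd (Int.gcd a b) (Int.gcd r s)}.Infinite}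

/-! Convergence is Borel–Cantelli: for `|ξ| ≤ R` a denominator `q = bn + s` admits `O(q)`
numerators, so its intervals have total length `O(q Ψ(q))`.

For divergence it suffices to treat the smaller set, with the gcd condition. Divide all data by `d =
gcd(a, b, r, s)`; Dirichlet's theorem then supplies coprime `p₀`, `q₀` in the reduced classes, and
only reduced fractions `p/q` congruent to `p₀/q₀` modulo a suitable `M` are kept. Those with `2^k <
q ≤ 2^(k+1)` are `4^(-k)/4`-separated, and a union bound over common divisors shows that an interval
of half-length `h` contains at least a constant times `h 4^k` of them
(`eventually_exists_subset_dyadicFractions`).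

Surround each by an interval of radius `ψ k`. Separation bounds the overlap of two scales `j ≤ k` by
a multiple of `h (u_j u_k + 4^(j-k) u_k)`, where `u_k = 4^k ψ k`. Since `∑ u_k` diverges by Cauchy
condensation, Chung–Erdős gives the limsup set a fixed proportion of every ball, and Lebesgue
density makes its complement null (`ae_frequently_exists_dist_lt`). -/

/-! ### Separated points and the second moment method -/

open Metric in
/-- The volume of a union of balls of radius `ψ` around a `2ψ`-separated finite set. -/
theorem volume_real_biUnion_ball {P : Finset ℝ} {δ ψ : ℝ} (hψ : 0 ≤ ψ) (hψδ : 2 * ψ ≤ δ)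
    (hsep : ∀ x ∈ P, ∀ y ∈ P, x ≠ y → δ ≤ |x - y|) :
    volume.real (⋃ x ∈ P, ball x ψ) = P.card * (2 * ψ) := by
  rw [measureReal_biUnion_finset]
  · simp [Real.volume_real_ball hψ]
  · intro x hx y hy hxy
    refine ball_disjoint_ball ?_
    have := hsep x hx y hy hxy
    rw [Real.dist_eq]; linarith
  · intro x _; exact measurableSet_ball

-- The balls of radius `δ / 2` around the points are disjoint and lie in the ball of radius `ρ + δ /
-- 2` around `z`; compare volumes.
open Metric in
theorem card_mul_le_of_separated {P : Finset ℝ} {z ρ δ : ℝ} (hδ : 0 < δ) (hρ : 0 ≤ ρ)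
    (hP : ∀ x ∈ P, |x - z| ≤ ρ) (hsep : ∀ x ∈ P, ∀ y ∈ P, x ≠ y → δ ≤ |x - y|) :
    P.card * δ ≤ 2 * ρ + δ := by
  have h1 := volume_real_biUnion_ball (P := P) (δ := δ) (ψ := δ / 2) (by linarith) (by linarith) hsep
  have h2 : (⋃ x ∈ P, ball x (δ / 2)) ⊆ ball z (ρ + δ / 2) := by
    refine Set.iUnion₂_subset fun x hx => ball_subset_ball' ?_
    have := hP x hx
    rw [Real.dist_eq]; linarith
  have h3 := measureReal_mono (μ := volume) h2 measure_ball_lt_top.ne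
  rw [h1, Real.volume_real_ball (by linarith)] at h3
  linarith

/-- The Chung–Erdős inequality. -/
theorem sq_sum_measureReal_le {α ι : Type*} [MeasurableSpace α] {μ : Measure α} (F : Finset ι)
    {A : ι → Set α} {E : Set α} (hA : ∀ i ∈ F, MeasurableSet (A i)) (hAE : ∀ i ∈ F, A i ⊆ E)
    (hE : MeasurableSet E) (hEfin : μ E ≠ ⊤) :
    (∑ i ∈ F, μ.real (A i)) ^ 2 ≤ μ.real E * ∑ i ∈ F, ∑ j ∈ F, μ.real (A i ∩ A j) := by
  set S : α → ℝ := fun x => ∑ i ∈ F, (A i).indicator (fun _ => (1 : ℝ)) x with hS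
  set m := ∑ i ∈ F, μ.real (A i)
  set v := ∑ i ∈ F, ∑ j ∈ F, μ.real (A i ∩ A j)
  have hfin : ∀ i ∈ F, μ (A i) ≠ ⊤ := fun i hi =>
    ne_top_of_le_ne_top hEfin (measure_mono (hAE i hi))
  -- The quadratic in `t` is `∫ (S - t 1_E)²`, expanded using `S 1_E = S`; its discriminant is
  -- therefore nonpositive.
  have key : ∀ t : ℝ, 0 ≤ μ.real E * (t * t) + (-2 * m) * t + v := by
    intro t
    have h0 : 0 ≤ ∫ x, (S x - t * E.indicator (fun _ => (1 : ℝ)) x) ^ 2 ∂μ :=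
      integral_nonneg fun x => sq_nonneg _
    have hpt : ∀ x, (S x - t * E.indicator (fun _ => (1 : ℝ)) x) ^ 2
        = (∑ i ∈ F, ∑ j ∈ F, (A i ∩ A j).indicator (fun _ => (1 : ℝ)) x)
          - 2 * t * (∑ i ∈ F, (A i).indicator (fun _ => (1 : ℝ)) x)
          + t * t * E.indicator (fun _ => (1 : ℝ)) x := by
      intro x
      have e1 : S x * E.indicator (fun _ => (1 : ℝ)) x = S x := by
        rw [hS, Finset.sum_mul]
        refine Finset.sum_congr rfl fun i hi => ?_
        by_cases hx : x ∈ A i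
        · simp [hx, hAE i hi hx]
        · simp [hx]
      have e2 : E.indicator (fun _ => (1 : ℝ)) x * E.indicator (fun _ => (1 : ℝ)) x
          = E.indicator (fun _ => (1 : ℝ)) x := by
        by_cases hx : x ∈ E <;> simp [hx]
      have e3 : S x * S x = ∑ i ∈ F, ∑ j ∈ F, (A i ∩ A j).indicator (fun _ => (1 : ℝ)) x := by
        rw [hS, Finset.sum_mul_sum]
        refine Finset.sum_congr rfl fun i _ => Finset.sum_congr rfl fun j _ => ?_
        by_cases hi : x ∈ A i <;> by_cases hj : x ∈ A j <;> simp [hi, hj]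
      rw [← e3]
      have : (∑ i ∈ F, (A i).indicator (fun _ => (1 : ℝ)) x) = S x := rfl
      rw [this]
      linear_combination (-2 * t) * e1 + t * t * e2
    have i1 : ∀ i ∈ F, Integrable ((A i).indicator (fun _ => (1 : ℝ))) μ := fun i hi =>
      (integrable_indicator_iff (hA i hi)).2 (integrableOn_const (hfin i hi))
    have i2 : ∀ i ∈ F, ∀ j ∈ F, Integrable ((A i ∩ A j).indicator (fun _ => (1 : ℝ))) μ :=
      fun i hi j hj => (integrable_indicator_iff ((hA i hi).inter (hA j hj))).2
        (integrableOn_const (ne_top_of_le_ne_top (hfin i hi) (measure_mono Set.inter_subset_left)))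
    have i3 : Integrable (E.indicator (fun _ => (1 : ℝ))) μ :=
      (integrable_indicator_iff hE).2 (integrableOn_const hEfin)
    have I1 : Integrable (fun x => ∑ i ∈ F, (A i).indicator (fun _ => (1 : ℝ)) x) μ :=
      integrable_finsetSum _ i1
    have I2 : Integrable
        (fun x => ∑ i ∈ F, ∑ j ∈ F, (A i ∩ A j).indicator (fun _ => (1 : ℝ)) x) μ :=
      integrable_finsetSum _ fun i hi => integrable_finsetSum _ (i2 i hi)
    have hint : ∀ B : Set α, MeasurableSet B →
        ∫ x, B.indicator (fun _ => (1 : ℝ)) x ∂μ = μ.real B := fun B hB => by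
      rw [integral_indicator_const _ hB]; simp
    have I3 : Integrable
        (fun x => (∑ i ∈ F, ∑ j ∈ F, (A i ∩ A j).indicator (fun _ => (1 : ℝ)) x)
          - 2 * t * (∑ i ∈ F, (A i).indicator (fun _ => (1 : ℝ)) x)) μ := I2.sub (I1.const_mul _)
    rw [integral_congr_ae (Filter.Eventually.of_forall hpt), integral_add
      I3 (i3.const_mul _), integral_sub I2 (I1.const_mul _),
      integral_const_mul, integral_const_mul, integral_finsetSum _ i1, integral_finsetSum _
      (fun i hi => integrable_finsetSum _ (i2 i hi)), hint E hE,
      Finset.sum_congr rfl (fun i hi => hint _ (hA i hi)),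
      Finset.sum_congr rfl (fun i hi => (integral_finsetSum _ (i2 i hi)).trans
        (Finset.sum_congr rfl (fun j hj => hint _ ((hA i hi).inter (hA j hj)))))] at h0
    linarith
  have := discrim_le_zero key
  rw [discrim] at this
  linarith

theorem sum_indicator_le_pow_div_pow (F : Finset ℕ) (k : ℕ) :
    ∑ j ∈ F, (if j ≤ k then (4 : ℝ) ^ j / 4 ^ k else 0) ≤ 2 := by
  rw [← Finset.sum_filter]
  calc ∑ j ∈ F with j ≤ k, (4 : ℝ) ^ j / 4 ^ k
      ≤ ∑ j ∈ Finset.range (k + 1), (4 : ℝ) ^ j / 4 ^ k := by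
        refine Finset.sum_le_sum_of_subset_of_nonneg (fun j hj => ?_) fun _ _ _ => by positivity
        simp only [Finset.mem_filter] at hj
        simp; omega
    _ ≤ 2 := by
        rw [← Finset.sum_div, geom_sum_eq (by norm_num), div_le_iff₀ (by positivity), pow_succ]
        have : (0 : ℝ) < 4 ^ k := by positivity
        linarith

/-! ### Ubiquity: from well-spread points to full measure -/

section Ubiquity

open Metric

variable {P : ℕ → Finset ℝ} {ψ : ℕ → ℝ} {z h : ℝ}

theorem card_le_of_separated {k : ℕ} (hh : 0 < h) (hbig : 1 ≤ h * 4 ^ k)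
    (hP : ∀ x ∈ P k, |x - z| ≤ h)
    (hsep : ∀ x ∈ P k, ∀ y ∈ P k, x ≠ y → 1 / (4 * 4 ^ k) ≤ |x - y|) :
    ((P k).card : ℝ) ≤ 9 * h * 4 ^ k := by
  have h1 := card_mul_le_of_separated (by positivity) hh.le hP hsep
  have h4 : (0 : ℝ) < 4 ^ k := by positivity
  have h2 : ((P k).card : ℝ) * (1 / (4 * 4 ^ k)) * (4 * 4 ^ k) ≤
      (2 * h + 1 / (4 * 4 ^ k)) * (4 * 4 ^ k) := by gcongr
  have e1 : ((P k).card : ℝ) * (1 / (4 * 4 ^ k)) * (4 * 4 ^ k) = (P k).card := by field_simp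
  have e2 : (2 * h + 1 / (4 * 4 ^ k)) * (4 * 4 ^ k) = 8 * h * 4 ^ k + 1 := by
    field_simp
    ring
  rw [e1, e2] at h2
  linarith

/-- Around each of the at most `9 h 4^j` points `x` of `P j`, only points of `P k` within `ψ j + ψ
k` matter, and separation leaves at most `8 * 4^k * ψ j + 2` of them. The first summand is
quasi-independence; the second comes from the `+ 2` and is small on average when `j ≤ k`. -/
theorem measureReal_inter_le_of_separated {j k : ℕ} (hh : 0 < h)
    (hbig : 1 ≤ h * 4 ^ j) (hψ0 : ∀ k, 0 < ψ k) (hψ : ψ k ≤ 1 / (8 * 4 ^ k))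
    (hP : ∀ x ∈ P j, |x - z| ≤ h)
    (hsepj : ∀ x ∈ P j, ∀ y ∈ P j, x ≠ y → 1 / (4 * 4 ^ j) ≤ |x - y|)
    (hsepk : ∀ x ∈ P k, ∀ y ∈ P k, x ≠ y → 1 / (4 * 4 ^ k) ≤ |x - y|) :
    volume.real ((⋃ x ∈ P j, ball x (ψ j)) ∩ ⋃ x ∈ P k, ball x (ψ k)) ≤
      144 * h * ((4 ^ j * ψ j) * (4 ^ k * ψ k)) + 36 * h * (4 ^ j / 4 ^ k * (4 ^ k * ψ k)) := by
  have h4 : (0 : ℝ) < 4 ^ k := by positivity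
  have hj0 := hψ0 j
  have hk0 := hψ0 k
  have h2ψ : 2 * ψ k ≤ 1 / (4 * 4 ^ k) := by
    have : (1 : ℝ) / (4 * 4 ^ k) = 2 * (1 / (8 * 4 ^ k)) := by field_simp; norm_num
    linarith
  have step : ∀ x ∈ P j, volume.real (ball x (ψ j) ∩ ⋃ y ∈ P k, ball y (ψ k)) ≤
      (8 * 4 ^ k * ψ j + 2) * (2 * ψ k) := by
    intro x _
    set R := (P k).filter (fun y => |y - x| ≤ ψ j + ψ k)
    have hsepR : ∀ y ∈ R, ∀ y' ∈ R, y ≠ y' → 1 / (4 * 4 ^ k) ≤ |y - y'| := fun y hy y' hy' =>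
      hsepk y (Finset.mem_filter.1 hy).1 y' (Finset.mem_filter.1 hy').1
    have hsub : ball x (ψ j) ∩ ⋃ y ∈ P k, ball y (ψ k) ⊆ ⋃ y ∈ R, ball y (ψ k) := by
      rintro t ⟨ht, ht'⟩
      simp only [Set.mem_iUnion] at ht' ⊢
      obtain ⟨y, hy, hty⟩ := ht'
      refine ⟨y, Finset.mem_filter.2 ⟨hy, ?_⟩, hty⟩
      rw [← Real.dist_eq]
      rw [mem_ball] at ht hty
      have := dist_triangle_left y x t
      linarith
    have hle := measureReal_mono (μ := volume) hsub
      ((measure_biUnion_lt_top R.finite_toSet fun y _ => measure_ball_lt_top).ne)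
    rw [volume_real_biUnion_ball hk0.le h2ψ hsepR] at hle
    refine hle.trans ?_
    have hc := card_mul_le_of_separated (P := R) (z := x) (ρ := ψ j + ψ k) (by positivity)
      (by linarith) (fun y hy => (Finset.mem_filter.1 hy).2) hsepR
    have hc2 : (R.card : ℝ) ≤ 8 * 4 ^ k * ψ j + 2 := by
      have h1 : (R.card : ℝ) * (1 / (4 * 4 ^ k)) ≤ 2 * ψ j + 2 * (1 / (4 * 4 ^ k)) := by linarith
      have h2 := mul_le_mul_of_nonneg_right h1 (by positivity : (0 : ℝ) ≤ 4 * 4 ^ k)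
      have e1 : (R.card : ℝ) * (1 / (4 * 4 ^ k)) * (4 * 4 ^ k) = R.card := by field_simp
      have e2 : (2 * ψ j + 2 * (1 / (4 * 4 ^ k))) * (4 * 4 ^ k) = 8 * 4 ^ k * ψ j + 2 := by
        field_simp
        ring
      rwa [e1, e2] at h2
    gcongr
  have hun : (⋃ x ∈ P j, ball x (ψ j)) ∩ (⋃ y ∈ P k, ball y (ψ k))
      = ⋃ x ∈ P j, (ball x (ψ j) ∩ ⋃ y ∈ P k, ball y (ψ k)) := by
    rw [Set.iUnion₂_inter]
  have hcard := card_le_of_separated hh hbig hP hsepj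
  calc _ ≤ ∑ x ∈ P j, volume.real (ball x (ψ j) ∩ ⋃ y ∈ P k, ball y (ψ k)) := by
        rw [hun]; exact measureReal_biUnion_finset_le _ _
    _ ≤ ∑ x ∈ P j, (8 * 4 ^ k * ψ j + 2) * (2 * ψ k) := Finset.sum_le_sum step
    _ = (P j).card * ((8 * 4 ^ k * ψ j + 2) * (2 * ψ k)) := by simp
    _ ≤ (9 * h * 4 ^ j) * ((8 * 4 ^ k * ψ j + 2) * (2 * ψ k)) := by gcongr
    _ = _ := by field_simp; ring

/-- Chung–Erdős over finitely many scales whose sum `U` of the `u k` is at least 1. The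
diagonal-type error `144 h U` is then absorbed into `144 h U²`, and the quotient of `(2 c h U)²` by
`288 h U²` no longer involves `U`. -/
theorem le_measureReal_iUnion_ball {c : ℝ} {n : ℕ} (hh : 0 < h) (hc : 0 < c)
    (hbig : ∀ k ≥ n, 1 ≤ h * 4 ^ k) (hψ0 : ∀ k, 0 < ψ k) (hψ : ∀ k, ψ k ≤ 1 / (8 * 4 ^ k))
    (hP : ∀ k ≥ n, ∀ x ∈ P k, |x - z| ≤ h)
    (hsep : ∀ k ≥ n, ∀ x ∈ P k, ∀ y ∈ P k, x ≠ y → 1 / (4 * 4 ^ k) ≤ |x - y|)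
    (hcard : ∀ k ≥ n, c * h * 4 ^ k ≤ (P k).card)
    (hdiv : ¬ Summable fun k => 4 ^ k * ψ k) {E : Set ℝ} (hE : MeasurableSet E)
    (hEfin : volume E ≠ ⊤) (hAE : ∀ k ≥ n, (⋃ x ∈ P k, ball x (ψ k)) ⊆ E) :
    c ^ 2 * h / 100 ≤ volume.real E := by
  set u : ℕ → ℝ := fun k => 4 ^ k * ψ k with hu
  have hu0 : ∀ k, 0 ≤ u k := fun k => by have := hψ0 k; positivity
  obtain ⟨N, hN⟩ : ∃ N, 1 ≤ ∑ k ∈ Finset.Ico n N, u k := by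
    by_contra! hcon
    refine hdiv ((summable_nat_add_iff n).1 (summable_of_sum_range_le (c := 1)
      (fun k => hu0 _) fun m => ?_))
    have := hcon (n + m)
    rw [Finset.sum_Ico_eq_sum_range] at this
    simp only [add_tsub_cancel_left] at this
    simp only [add_comm _ n]
    exact this.le
  set F := Finset.Ico n N
  set U := ∑ k ∈ F, u k
  have hF : ∀ k ∈ F, n ≤ k := fun k hk => (Finset.mem_Ico.1 hk).1
  set A : ℕ → Set ℝ := fun k => ⋃ x ∈ P k, ball x (ψ k)
  have hpair : ∀ j ∈ F, ∀ k ∈ F, volume.real (A j ∩ A k) ≤ 144 * h * (u j * u k)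
      + 36 * h * ((if j ≤ k then (4 : ℝ) ^ j / 4 ^ k else 0) * u k)
      + 36 * h * ((if k ≤ j then (4 : ℝ) ^ k / 4 ^ j else 0) * u j) := by
    intro j hj k hk
    have hj' := hF j hj
    have hk' := hF k hk
    rcases le_total j k with hjk | hjk
    · have := measureReal_inter_le_of_separated hh (hbig j hj') hψ0 (hψ k) (hP j hj')
        (hsep j hj') (hsep k hk')
      rw [if_pos hjk]
      have h0 : 0 ≤ 36 * h * ((if k ≤ j then (4 : ℝ) ^ k / 4 ^ j else 0) * u j) := by
        have := hu0 j
        split_ifs <;> positivity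
      linarith
    · have := measureReal_inter_le_of_separated hh (hbig k hk') hψ0 (hψ j) (hP k hk')
        (hsep k hk') (hsep j hj')
      rw [if_pos hjk, Set.inter_comm]
      have h0 : 0 ≤ 36 * h * ((if j ≤ k then (4 : ℝ) ^ j / 4 ^ k else 0) * u k) := by
        have := hu0 k
        split_ifs <;> positivity
      have e : u j * u k = u k * u j := mul_comm _ _
      rw [e]
      linarith
  have hhalf : ∑ k ∈ F, ∑ j ∈ F, (if j ≤ k then (4 : ℝ) ^ j / 4 ^ k else 0) * u k ≤ 2 * U := by
    rw [Finset.mul_sum]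
    refine Finset.sum_le_sum fun k _ => ?_
    rw [← Finset.sum_mul]
    exact mul_le_mul_of_nonneg_right (sum_indicator_le_pow_div_pow F k) (hu0 k)
  have hsecond : ∑ j ∈ F, ∑ k ∈ F, volume.real (A j ∩ A k) ≤ 288 * h * U ^ 2 := by
    calc _ ≤ ∑ j ∈ F, ∑ k ∈ F, (144 * h * (u j * u k)
          + 36 * h * ((if j ≤ k then (4 : ℝ) ^ j / 4 ^ k else 0) * u k)
          + 36 * h * ((if k ≤ j then (4 : ℝ) ^ k / 4 ^ j else 0) * u j)) :=
          Finset.sum_le_sum fun j hj => Finset.sum_le_sum fun k hk => hpair j hj k hk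
      _ = 144 * h * U ^ 2
          + 36 * h * (∑ k ∈ F, ∑ j ∈ F, (if j ≤ k then (4 : ℝ) ^ j / 4 ^ k else 0) * u k)
          + 36 * h * (∑ k ∈ F, ∑ j ∈ F, (if j ≤ k then (4 : ℝ) ^ j / 4 ^ k else 0) * u k) := by
          simp only [Finset.sum_add_distrib, ← Finset.mul_sum]
          congr 2
          · rw [sq, Finset.sum_mul]
          · rw [Finset.sum_comm]
      _ ≤ 144 * h * U ^ 2 + 36 * h * (2 * U) + 36 * h * (2 * U) := by gcongr
      _ ≤ _ := by nlinarith [mul_nonneg hh.le (mul_nonneg (by linarith : 0 ≤ U) (by linarith : 0 ≤ U - 1))]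
  have hfirst : 2 * c * h * U ≤ ∑ k ∈ F, volume.real (A k) := by
    rw [Finset.mul_sum]
    refine Finset.sum_le_sum fun k hk => ?_
    have h2ψ : 2 * ψ k ≤ 1 / (4 * 4 ^ k) := by
      have : (1 : ℝ) / (4 * 4 ^ k) = 2 * (1 / (8 * 4 ^ k)) := by field_simp; norm_num
      have := hψ k
      linarith
    rw [volume_real_biUnion_ball (hψ0 k).le h2ψ (hsep k (hF k hk))]
    have := mul_le_mul_of_nonneg_right (hcard k (hF k hk))
      (mul_nonneg zero_le_two (hψ0 k).le)
    calc 2 * c * h * u k = c * h * 4 ^ k * (2 * ψ k) := by simp only [hu]; ring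
      _ ≤ _ := this
  have hCE := sq_sum_measureReal_le (μ := volume) F (A := A) (E := E)
    (fun k _ => Finset.measurableSet_biUnion _ fun _ _ => measurableSet_ball)
    (fun k hk => hAE k (hF k hk)) hE hEfin
  have h0 : 0 ≤ volume.real E := measureReal_nonneg
  have hU : 0 < U := by linarith
  have h1 : (2 * c * h * U) ^ 2 ≤ volume.real E * (288 * h * U ^ 2) :=
    (pow_le_pow_left₀ (by positivity) hfirst 2).trans (hCE.trans (by gcongr))
  have h2 : (c ^ 2 * h / 72) * (288 * h * U ^ 2) ≤ volume.real E * (288 * h * U ^ 2) := by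
    calc _ = (2 * c * h * U) ^ 2 := by ring
      _ ≤ _ := h1
  have h3 := le_of_mul_le_mul_right h2 (by positivity)
  have : 0 < c ^ 2 * h := by positivity
  linarith

open Filter Topology in
/-- A ubiquity criterion: if at scale `k` the set `X k` is `4⁻ᵏ/4`-separated and meets every ball in
a positive proportion of the maximal possible number of points, then almost every point is
`ψ k`-close to `X k` for infinitely many `k`. -/
theorem ae_frequently_exists_dist_lt {X : ℕ → Set ℝ} {c : ℝ} (hc : 0 < c)
    (hψ0 : ∀ k, 0 < ψ k) (hψ : ∀ k, ψ k ≤ 1 / (8 * 4 ^ k))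
    (hdiv : ¬ Summable fun k => 4 ^ k * ψ k)
    (hsep : ∀ k, ∀ x ∈ X k, ∀ y ∈ X k, x ≠ y → 1 / (4 * 4 ^ k) ≤ |x - y|)
    (hX : ∀ z h : ℝ, 0 < h → ∀ᶠ k in atTop, ∃ P : Finset ℝ, (∀ x ∈ P, x ∈ X k ∧ |x - z| ≤ h) ∧
      c * h * 4 ^ k ≤ P.card) :
    ∀ᵐ ξ : ℝ, ∃ᶠ k in atTop, ∃ x ∈ X k, dist ξ x < ψ k := by
  set V : ℕ → Set ℝ := fun n => ⋃ k ≥ n, ⋃ x ∈ X k, ball x (ψ k) with hV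
  set W : Set ℝ := ⋂ n, V n with hW
  have hVo : ∀ n, IsOpen (V n) := fun n =>
    isOpen_biUnion fun k _ => isOpen_biUnion fun x _ => isOpen_ball
  have hWm : MeasurableSet W := MeasurableSet.iInter fun n => (hVo n).measurableSet
  have hVanti : Antitone V := fun m n hmn =>
    Set.biUnion_subset_biUnion_left fun k (hk : n ≤ k) => hmn.trans hk
  have hWsub : ∀ ξ ∈ W, ∃ᶠ k in atTop, ∃ x ∈ X k, dist ξ x < ψ k := by
    intro ξ hξ
    rw [frequently_atTop]
    intro n
    have := Set.mem_iInter.1 hξ n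
    simp only [hV, Set.mem_iUnion, mem_ball] at this
    obtain ⟨k, hk, x, hx, hd⟩ := this
    exact ⟨k, hk, x, hx, hd⟩
  have hball : ∀ z h : ℝ, 0 < h → c ^ 2 * h / 100 ≤ volume.real (W ∩ closedBall z (2 * h)) := by
    intro z h hh
    have hbig : ∀ᶠ k : ℕ in atTop, 1 ≤ h * 4 ^ k :=
      ((tendsto_pow_atTop_atTop_of_one_lt (by norm_num : (1 : ℝ) < 4)).const_mul_atTop hh).eventually_ge_atTop 1
    obtain ⟨n₀, hn₀⟩ := eventually_atTop.1 (hbig.and (hX z h hh))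
    have hP : ∀ k, ∃ P : Finset ℝ, n₀ ≤ k → (∀ x ∈ P, x ∈ X k ∧ |x - z| ≤ h) ∧
        c * h * 4 ^ k ≤ P.card := fun k => by
      by_cases hk : n₀ ≤ k
      · obtain ⟨P, hP⟩ := (hn₀ k hk).2
        exact ⟨P, fun _ => hP⟩
      · exact ⟨∅, fun h => absurd h hk⟩
    choose P hP using hP
    have hVn : ∀ n ≥ n₀, c ^ 2 * h / 100 ≤ volume.real (V n ∩ closedBall z (2 * h)) := by
      intro n hn
      refine le_measureReal_iUnion_ball (P := P) (z := z) (n := n) hh hc (fun k hk => (hn₀ k (hn.le.trans hk)).1)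
        hψ0 hψ (fun k hk x hx => ((hP k (hn.le.trans hk)).1 x hx).2)
        (fun k hk x hx y hy => hsep k x ((hP k (hn.le.trans hk)).1 x hx).1 y
          ((hP k (hn.le.trans hk)).1 y hy).1) (fun k hk => (hP k (hn.le.trans hk)).2) hdiv
        ((hVo n).measurableSet.inter measurableSet_closedBall)
        (ne_top_of_le_ne_top measure_closedBall_lt_top.ne (measure_mono Set.inter_subset_right)) ?_
      intro k hk
      refine Set.iUnion₂_subset fun x hx => ?_
      have hx' := (hP k (hn.le.trans hk)).1 x hx
      refine Set.subset_inter (fun t ht => ?_) ?_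
      · simp only [hV, Set.mem_iUnion]
        exact ⟨k, hk, x, hx'.1, ht⟩
      · refine ball_subset_closedBall.trans (closedBall_subset_closedBall' ?_)
        have h1 := (hn₀ k (hn.le.trans hk)).1
        have h2 : ψ k ≤ h := by
          refine (hψ k).trans ?_
          rw [div_le_iff₀ (by positivity)]
          linarith
        rw [Real.dist_eq]
        linarith [hx'.2]
    -- The lower bound is uniform in `n`, so it survives the decreasing intersection.
    have htend : Tendsto (fun n => volume (V n ∩ closedBall z (2 * h))) atTop
        (𝓝 (volume (⋂ n, V n ∩ closedBall z (2 * h)))) :=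
      tendsto_measure_iInter_atTop
        (fun n => ((hVo n).measurableSet.inter measurableSet_closedBall).nullMeasurableSet)
        (fun m n hmn => Set.inter_subset_inter_left _ (hVanti hmn))
        ⟨0, ne_top_of_le_ne_top measure_closedBall_lt_top.ne (measure_mono Set.inter_subset_right)⟩
    rw [← Set.iInter_inter] at htend
    have hfinW : volume (W ∩ closedBall z (2 * h)) ≠ ⊤ :=
      ne_top_of_le_ne_top measure_closedBall_lt_top.ne (measure_mono Set.inter_subset_right)
    exact ge_of_tendsto ((ENNReal.tendsto_toReal hfinW).comp htend)
      (eventually_atTop.2 ⟨n₀, hVn⟩)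
  -- With `h = r / 2`, `W` occupies at least `c² r / 200` of the length `2 r`.
  have hcompl : ∀ z r : ℝ, 0 < r →
      volume (Wᶜ ∩ closedBall z r) / volume (closedBall z r) ≤ ENNReal.ofReal (1 - c ^ 2 / 400) := by
    intro z r hr
    have h1 := hball z (r / 2) (by linarith)
    rw [mul_div_cancel₀ r two_ne_zero] at h1
    have h2 : volume.real (closedBall z r ∩ W) + volume.real (closedBall z r \ W)
      = volume.real (closedBall z r) :=
      measureReal_inter_add_sdiff hWm measure_closedBall_lt_top.ne
    rw [Real.volume_real_closedBall hr.le, Set.sdiff_eq, Set.inter_comm _ W,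
      Set.inter_comm _ Wᶜ] at h2
    have h3 : volume.real (Wᶜ ∩ closedBall z r) ≤ (1 - c ^ 2 / 400) * (2 * r) := by linarith
    refine ENNReal.div_le_of_le_mul ?_
    rw [Real.volume_closedBall, ← ENNReal.ofReal_mul' (by linarith)]
    refine ENNReal.le_ofReal_iff_toReal_le ?_ ?_ |>.2 ?_
    · exact ne_top_of_le_ne_top measure_closedBall_lt_top.ne (measure_mono Set.inter_subset_right)
    · exact measureReal_nonneg.trans h3
    · exact h3
  -- Almost every point of `Wᶜ` is a density point of `Wᶜ`, yet the densities stay below `1 - c² /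
  -- 400`.
  have hnull : ∀ᵐ z ∂(volume.restrict Wᶜ), False := by
    filter_upwards [Besicovitch.ae_tendsto_measure_inter_div (volume : Measure ℝ) Wᶜ] with z hz
    have hle : (1 : ENNReal) ≤ ENNReal.ofReal (1 - c ^ 2 / 400) :=
      le_of_tendsto hz (eventually_nhdsWithin_of_forall fun r hr => hcompl z r hr)
    have : ENNReal.ofReal (1 - c ^ 2 / 400) < 1 := by
      rw [ENNReal.ofReal_lt_one]
      have : 0 < c ^ 2 := by positivity
      linarith
    exact absurd hle (not_le.2 this)
  rw [Filter.eventually_false_iff_eq_bot, ae_eq_bot, Measure.restrict_eq_zero] at hnull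
  refine measure_mono_null (fun ξ hξ => ?_) hnull
  exact fun hW' => hξ (hWsub ξ hW')

end Ubiquity

/-! ### Counting reduced fractions in residue classes -/

open Finset in
theorem card_Ioc_modEq_bounds {A B M : ℤ} (hM : 0 < M) (hAB : A ≤ B) (v : ℤ) :
    ((B : ℝ) - A) / M - 1 ≤ (#{x ∈ Ioc A B | x ≡ v [ZMOD M]} : ℝ) ∧
      (#{x ∈ Ioc A B | x ≡ v [ZMOD M]} : ℝ) ≤ ((B : ℝ) - A) / M + 1 := by
  have hM' : (0 : ℚ) < M := by exact_mod_cast hM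
  have h := Int.Ioc_filter_modEq_card A B hM v
  have hq : ((#{x ∈ Ioc A B | x ≡ v [ZMOD M]} : ℤ) : ℚ)
      = max ((⌊((B : ℚ) - v) / M⌋ : ℚ) - ⌊((A : ℚ) - v) / M⌋) 0 := by
    rw [h]; push_cast; rfl
  have h1 := Int.floor_le (((B : ℚ) - v) / M)
  have h2 := Int.lt_floor_add_one (((B : ℚ) - v) / M)
  have h3 := Int.floor_le (((A : ℚ) - v) / M)
  have h4 := Int.lt_floor_add_one (((A : ℚ) - v) / M)
  have e : ((B : ℚ) - A) / M = ((B : ℚ) - v) / M - ((A : ℚ) - v) / M := by ring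
  have hn : (0 : ℚ) ≤ ((B : ℚ) - A) / M := by
    have : (A : ℚ) ≤ B := by exact_mod_cast hAB
    exact div_nonneg (by linarith) hM'.le
  have r1 : ((B : ℚ) - A) / M - 1 ≤ (#{x ∈ Ioc A B | x ≡ v [ZMOD M]} : ℚ) := by
    have := le_max_left ((⌊((B : ℚ) - v) / M⌋ : ℚ) - ⌊((A : ℚ) - v) / M⌋) 0
    push_cast at hq
    rw [hq]; linarith
  have r2 : (#{x ∈ Ioc A B | x ≡ v [ZMOD M]} : ℚ) ≤ ((B : ℚ) - A) / M + 1 := by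
    push_cast at hq
    rw [hq]
    exact max_le (by linarith) (by linarith)
  exact ⟨by exact_mod_cast r1, by exact_mod_cast r2⟩

-- By the Chinese remainder theorem the two conditions, if solvable, define one class modulo `M *
-- e`.
open Finset in
theorem card_Ioc_modEq_and_dvd_le {A B M e : ℤ} (hM : 0 < M) (he : 0 < e) (hMe : IsCoprime M e)
    (hAB : A ≤ B) (v : ℤ) :
    (#{x ∈ Ioc A B | x ≡ v [ZMOD M] ∧ e ∣ x} : ℝ) ≤ ((B : ℝ) - A) / (M * e) + 1 := by
  rcases (Finset.filter (fun x => x ≡ v [ZMOD M] ∧ e ∣ x) (Ioc A B)).eq_empty_or_nonempty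
    with h0 | ⟨w, hw⟩
  · rw [h0, card_empty]
    have : (A : ℝ) ≤ B := by exact_mod_cast hAB
    have : (0 : ℝ) < M := by exact_mod_cast hM
    have : (0 : ℝ) < e := by exact_mod_cast he
    have : 0 ≤ ((B : ℝ) - A) / (M * e) := div_nonneg (by linarith) (by positivity)
    push_cast; linarith
  · have hw := (mem_filter.1 hw).2
    have h2 := (card_Ioc_modEq_bounds (mul_pos hM he) hAB w).2
    push_cast at h2
    refine le_trans (Nat.cast_le.2 (card_le_card fun x hx => ?_)) h2
    have hx' := mem_filter.1 hx
    refine mem_filter.2 ⟨hx'.1, ?_⟩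
    refine (Int.modEq_and_modEq_iff_modEq_mul ?_).1 ⟨hx'.2.1.trans hw.1.symm, ?_⟩
    · exact Int.isCoprime_iff_gcd_eq_one.1 hMe
    · exact (Int.modEq_zero_iff_dvd.2 hx'.2.2).trans (Int.modEq_zero_iff_dvd.2 hw.2).symm

open Finset in
theorem sum_Ioc_inv_sq_le (n : ℕ) : ∑ e ∈ Ioc 4 n, ((e : ℝ) ^ 2)⁻¹ ≤ 1 / 4 := by
  rcases le_total 4 n with h | h
  · have := sum_Ioc_inv_sq_le_sub (α := ℝ) (k := 4) (by norm_num) h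
    have h2 : (0 : ℝ) ≤ (n : ℝ)⁻¹ := by positivity
    push_cast at this
    linarith
  · rw [Ioc_eq_empty (by omega)]; norm_num

-- By AM-GM, `1 / e ≤ η + e⁻² / η`. As `η` is free this gives `o(n)`, so no logarithmic estimate is
-- needed.
open Finset in
theorem sum_Ioc_inv_le {η : ℝ} (hη : 0 < η) (n : ℕ) :
    ∑ e ∈ Ioc 4 n, (e : ℝ)⁻¹ ≤ η * n + 1 / η := by
  calc ∑ e ∈ Ioc 4 n, (e : ℝ)⁻¹ ≤ ∑ e ∈ Ioc 4 n, (η + 1 / η * ((e : ℝ) ^ 2)⁻¹) := by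
        refine sum_le_sum fun e _ => ?_
        have h1 := sq_nonneg (η - (e : ℝ)⁻¹)
        have h2 : 0 ≤ (e : ℝ)⁻¹ := by positivity
        have h3 : (e : ℝ)⁻¹ * η ≤ (η + 1 / η * ((e : ℝ) ^ 2)⁻¹) * η := by
          rw [add_mul, mul_right_comm, one_div, inv_mul_cancel₀ hη.ne', ← inv_pow]
          nlinarith
        exact le_of_mul_le_mul_right h3 hη
    _ = η * (n - 4 : ℕ) + 1 / η * ∑ e ∈ Ioc 4 n, ((e : ℝ) ^ 2)⁻¹ := by
        rw [sum_add_distrib, ← mul_sum]; simp [mul_comm]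
    _ ≤ η * n + 1 / η * 1 := by
        gcongr
        · omega
        · exact (sum_Ioc_inv_sq_le n).trans (by norm_num)
    _ = _ := by ring

open Finset in
/-- A lower bound for the number of reduced fractions in a short interval whose numerators and
denominators lie in fixed residue classes, up to the estimate of the error terms. -/
theorem card_coprime_modEq_ge {M Q : ℕ} (h6 : 6 ∣ M) (hM : 0 < M) (hQ : 0 < Q) {p₀ q₀ : ℤ}
    (hcop : IsCoprime p₀ q₀) {z h : ℝ} (hh : 0 < h) (hQM : (M : ℝ) ≤ Q * h) (hQM' : M ≤ Q) :
    (((Q : ℝ) / M - 1) * (2 * h * Q / M - 2)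
        - ∑ e ∈ Ioc 4 (2 * Q), ((Q : ℝ) / (M * e) + 1) * (4 * h * Q / (M * e) + 2)) ≤
      #{x ∈ ({q ∈ Ioc (Q : ℤ) (2 * Q) | q ≡ q₀ [ZMOD M]}).sigma
        (fun q => {p ∈ Ioc ⌊(q : ℝ) * (z - h)⌋ ⌊(q : ℝ) * (z + h)⌋ | p ≡ p₀ [ZMOD M]}) |
          IsCoprime x.2 x.1} := by
  classical
  have hM' : (0 : ℝ) < M := by exact_mod_cast hM
  have hMz : (0 : ℤ) < M := by exact_mod_cast hM
  have hQ' : (0 : ℝ) < Q := by exact_mod_cast hQ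
  set Qs := {q ∈ Ioc (Q : ℤ) (2 * Q) | q ≡ q₀ [ZMOD M]} with hQs
  set Ps : ℤ → Finset ℤ := fun q =>
    {p ∈ Ioc ⌊(q : ℝ) * (z - h)⌋ ⌊(q : ℝ) * (z + h)⌋ | p ≡ p₀ [ZMOD M]} with hPs
  set G := Qs.sigma Ps
  have hfl : ∀ q : ℤ, (Q : ℤ) < q → ⌊(q : ℝ) * (z - h)⌋ ≤ ⌊(q : ℝ) * (z + h)⌋ := fun q hq => by
    have : (0 : ℝ) ≤ q := by
      have : (Q : ℝ) < q := by exact_mod_cast hq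
      linarith
    exact Int.floor_le_floor (by gcongr; linarith)
  have hGcard : ((Q : ℝ) / M - 1) * (2 * h * Q / M - 2) ≤ #G := by
    have h2 : (0 : ℝ) ≤ 2 * h * Q / M - 2 := by
      rw [sub_nonneg, le_div_iff₀ hM']; linarith
    have h1 : (Q : ℝ) / M - 1 ≤ #Qs := by
      have := (card_Ioc_modEq_bounds hMz (by omega : (Q : ℤ) ≤ 2 * Q) q₀).1
      push_cast at this
      refine le_trans (le_of_eq ?_) this
      ring
    rw [card_sigma]
    push_cast
    calc _ ≤ (#Qs : ℝ) * (2 * h * Q / M - 2) := by gcongr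
      _ = ∑ q ∈ Qs, (2 * h * Q / M - 2) := by rw [sum_const, nsmul_eq_mul]
      _ ≤ _ := by
        refine sum_le_sum fun q hq => ?_
        have hq1 := (mem_Ioc.1 (mem_filter.1 hq).1)
        have hqr : (Q : ℝ) < q := by exact_mod_cast hq1.1
        have := (card_Ioc_modEq_bounds hMz (hfl q hq1.1) p₀).1
        refine le_trans ?_ this
        have f1 := Int.lt_floor_add_one ((q : ℝ) * (z + h))
        have f2 := Int.floor_le ((q : ℝ) * (z - h))
        have f3 : 2 * h * Q - 1 ≤ (⌊(q : ℝ) * (z + h)⌋ : ℝ) - ⌊(q : ℝ) * (z - h)⌋ := by nlinarith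
        have f4 : (1 : ℝ) / M ≤ 1 := by
          rw [div_le_one hM']; exact_mod_cast hM
        have f5 : (2 * h * Q - 1) / M ≤
          ((⌊(q : ℝ) * (z + h)⌋ : ℝ) - ⌊(q : ℝ) * (z - h)⌋) / M := by gcongr
        rw [sub_div] at f5
        push_cast
        linarith
  -- Pairs with common divisor `e`; the non-coprime pairs are removed by a union bound over `e`.
  set Bad : ℕ → Finset (Σ _ : ℤ, ℤ) := fun e =>
    ({q ∈ Ioc (Q : ℤ) (2 * Q) | q ≡ q₀ [ZMOD M] ∧ (e : ℤ) ∣ q}).sigma (fun q =>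
      {p ∈ Ioc ⌊(q : ℝ) * (z - h)⌋ ⌊(q : ℝ) * (z + h)⌋ | p ≡ p₀ [ZMOD M] ∧ (e : ℤ) ∣ p}) with hBad
  have hBadcard : ∀ e : ℕ, 0 < e → IsCoprime (M : ℤ) (e : ℤ) →
      (#(Bad e) : ℝ) ≤ ((Q : ℝ) / (M * e) + 1) * (4 * h * Q / (M * e) + 2) := by
    intro e he hMe
    have hez : (0 : ℤ) < e := by exact_mod_cast he
    have her : (0 : ℝ) < e := by exact_mod_cast he
    rw [card_sigma]
    push_cast
    have h1 : (#{q ∈ Ioc (Q : ℤ) (2 * Q) | q ≡ q₀ [ZMOD M] ∧ (e : ℤ) ∣ q} : ℝ)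
        ≤ (Q : ℝ) / (M * e) + 1 := by
      have := card_Ioc_modEq_and_dvd_le hMz hez hMe (by omega : (Q : ℤ) ≤ 2 * Q) q₀
      push_cast at this
      refine this.trans (le_of_eq ?_)
      ring
    calc _ ≤ ∑ q ∈ {q ∈ Ioc (Q : ℤ) (2 * Q) | q ≡ q₀ [ZMOD M] ∧ (e : ℤ) ∣ q},
          (4 * h * Q / (M * e) + 2) := by
          refine sum_le_sum fun q hq => ?_
          have hq1 := (mem_Ioc.1 (mem_filter.1 hq).1)
          have hqr : (q : ℝ) ≤ 2 * Q := by exact_mod_cast hq1.2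
          have := card_Ioc_modEq_and_dvd_le hMz hez hMe (hfl q hq1.1) p₀
          refine this.trans ?_
          have f1 := Int.floor_le ((q : ℝ) * (z + h))
          have f2 := Int.lt_floor_add_one ((q : ℝ) * (z - h))
          have f3 : (⌊(q : ℝ) * (z + h)⌋ : ℝ) - ⌊(q : ℝ) * (z - h)⌋ ≤ 4 * h * Q + 1 := by nlinarith
          have f4 : (1 : ℝ) / (M * e) ≤ 1 := by
            rw [div_le_one (by positivity)]
            exact_mod_cast Nat.mul_pos hM he
          have f5 : ((⌊(q : ℝ) * (z + h)⌋ : ℝ) - ⌊(q : ℝ) * (z - h)⌋) / (M * e) ≤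
            (4 * h * Q + 1) / (M * e) := by gcongr
          rw [add_div] at f5
          push_cast
          linarith
      _ = (#{q ∈ Ioc (Q : ℤ) (2 * Q) | q ≡ q₀ [ZMOD M] ∧ (e : ℤ) ∣ q} : ℝ)
          * (4 * h * Q / (M * e) + 2) := by rw [sum_const, nsmul_eq_mul]
      _ ≤ _ := by gcongr
  have hcover : G ⊆ {x ∈ G | IsCoprime x.2 x.1} ∪
      ((Ioc 4 (2 * Q)).filter (fun e : ℕ => IsCoprime (M : ℤ) e)).biUnion Bad := by
    rintro ⟨q, p⟩ hx
    rw [mem_union]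
    by_cases hpq : IsCoprime p q
    · exact Or.inl (mem_filter.2 ⟨hx, hpq⟩)
    right
    obtain ⟨hq, hp⟩ := mem_sigma.1 hx
    simp only [hQs, hPs, mem_filter, mem_Ioc] at hq hp
    set e := Int.gcd p q with he
    have hep : (e : ℤ) ∣ p := Int.gcd_dvd_left ..
    have heq : (e : ℤ) ∣ q := Int.gcd_dvd_right ..
    -- A prime dividing `M` and `e` would divide both `p₀` and `q₀`.
    have heM : IsCoprime (M : ℤ) (e : ℤ) := by
      rw [Int.isCoprime_iff_gcd_eq_one, Int.gcd_natCast_natCast]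
      refine Nat.coprime_of_dvd fun ℓ hℓ h1 h2 => ?_
      have h1' : (ℓ : ℤ) ∣ M := by exact_mod_cast h1
      have h2' : (ℓ : ℤ) ∣ e := by exact_mod_cast h2
      have d1 : (ℓ : ℤ) ∣ p₀ := (Int.ModEq.dvd_iff (hp.2.of_dvd h1')).1 (h2'.trans hep)
      have d2 : (ℓ : ℤ) ∣ q₀ := (Int.ModEq.dvd_iff (hq.2.of_dvd h1')).1 (h2'.trans heq)
      have := hcop.isUnit_of_dvd' d1 d2
      rw [Int.isUnit_iff_natAbs_eq, Int.natAbs_natCast] at this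
      exact hℓ.one_lt.ne' this
    have hle : e ≤ 2 * Q := by
      have := Int.le_of_dvd (by omega) heq
      omega
    have h0 : 0 < e := Int.gcd_pos_of_ne_zero_right _ (by omega)
    have h1 : e ≠ 1 := fun h => hpq (Int.isCoprime_iff_gcd_eq_one.2 h)
    rw [Int.isCoprime_iff_gcd_eq_one, Int.gcd_natCast_natCast] at heM
    have h6e : Nat.Coprime 6 e := Nat.Coprime.coprime_dvd_left h6 heM
    -- This is the purpose of `6 ∣ M`: a nontrivial `e` prime to 6 is at least 5, and `∑ e⁻²` over
    -- `e > 4` is small enough for the union bound.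
    have h4 : 4 < e := by
      by_contra! hlt
      clear_value e
      clear hBadcard
      revert h1 h6e
      interval_cases e <;> decide
    refine mem_biUnion.2 ⟨e, mem_filter.2 ⟨mem_Ioc.2 ⟨h4, hle⟩, ?_⟩, ?_⟩
    · rw [Int.isCoprime_iff_gcd_eq_one, Int.gcd_natCast_natCast]
      exact heM
    · refine mem_sigma.2 ⟨?_, ?_⟩
      · simp only [mem_filter, mem_Ioc]
        exact ⟨hq.1, hq.2, heq⟩
      · simp only [mem_filter, mem_Ioc]
        exact ⟨hp.1, hp.2, hep⟩
  have hle : (#G : ℝ) ≤ #{x ∈ G | IsCoprime x.2 x.1} +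
      ∑ e ∈ Ioc 4 (2 * Q), ((Q : ℝ) / (M * e) + 1) * (4 * h * Q / (M * e) + 2) := by
    have h1 := (card_le_card hcover).trans (card_union_le _ _)
    have h2 : #(((Ioc 4 (2 * Q)).filter (fun e : ℕ => IsCoprime (M : ℤ) e)).biUnion Bad) ≤ _ :=
      card_biUnion_le
    have h3 := h1.trans (Nat.add_le_add_left h2 _)
    refine (Nat.cast_le (α := ℝ).2 h3).trans ?_
    push_cast
    gcongr
    calc _ ≤ ∑ e ∈ (Ioc 4 (2 * Q)).filter (fun e : ℕ => IsCoprime (M : ℤ) e),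
          ((Q : ℝ) / (M * e) + 1) * (4 * h * Q / (M * e) + 2) := by
          refine sum_le_sum fun e he => ?_
          obtain ⟨he1, he2⟩ := mem_filter.1 he
          exact hBadcard e (by have := (mem_Ioc.1 he1).1; omega) he2
      _ ≤ _ := sum_le_sum_of_subset_of_nonneg (filter_subset _ _) fun _ _ _ => by positivity
  linarith

-- In units of `h Q² / (4 M²)`: the main term is 8, the `e⁻²` sum costs at most 4, the `e⁻¹` sum
-- costs 1 by the choice of `η` (plus a term linear in `Q`), and all linear terms together cost at
-- most 1 for large `Q`. This leaves 2.
open Finset in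
theorem le_sub_sum_Ioc {M : ℕ} (hM : 0 < M) {h : ℝ} (hh : 0 < h) :
    ∀ᶠ Q : ℕ in Filter.atTop, 1 / (2 * (M : ℝ) ^ 2) * h * (Q : ℝ) ^ 2 ≤
      ((Q : ℝ) / M - 1) * (2 * h * Q / M - 2)
        - ∑ e ∈ Ioc 4 (2 * Q), ((Q : ℝ) / (M * e) + 1) * (4 * h * Q / (M * e) + 2) := by
  have hM' : (0 : ℝ) < M := by exact_mod_cast hM
  set η : ℝ := h / (16 * M * (1 + 2 * h)) with hη
  have hη0 : 0 < η := by positivity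
  set C : ℝ := (2 + 2 * h) / M + 2 * (1 + 2 * h) * (1 / η) / M + 4 with hC
  have hlarge : ∀ᶠ Q : ℕ in Filter.atTop, C ≤ h / (4 * (M : ℝ) ^ 2) * Q :=
    (tendsto_natCast_atTop_atTop.const_mul_atTop (by positivity)).eventually_ge_atTop C
  filter_upwards [hlarge] with Q hQ
  have hQ0 : (0 : ℝ) ≤ Q := by positivity
  have hsum : ∑ e ∈ Ioc 4 (2 * Q), ((Q : ℝ) / (M * e) + 1) * (4 * h * Q / (M * e) + 2)
      = 4 * h * Q ^ 2 / M ^ 2 * (∑ e ∈ Ioc 4 (2 * Q), ((e : ℝ) ^ 2)⁻¹)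
        + 2 * Q * (1 + 2 * h) / M * (∑ e ∈ Ioc 4 (2 * Q), (e : ℝ)⁻¹) + 2 * (2 * Q - 4 : ℕ) := by
    have : (2 * (2 * Q - 4 : ℕ) : ℝ) = ∑ e ∈ Ioc 4 (2 * Q), (2 : ℝ) := by simp [mul_comm]
    rw [this, mul_sum, mul_sum, ← sum_add_distrib, ← sum_add_distrib]
    refine sum_congr rfl fun e he => ?_
    have : (0 : ℝ) < e := by
      have := (mem_Ioc.1 he).1
      exact_mod_cast (by omega : 0 < e)
    field_simp
    ring
  have h1 : 4 * h * Q ^ 2 / M ^ 2 * (∑ e ∈ Ioc 4 (2 * Q), ((e : ℝ) ^ 2)⁻¹)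
      ≤ 4 * h * Q ^ 2 / M ^ 2 * (1 / 4) := by
    gcongr; exact sum_Ioc_inv_sq_le _
  have h2 : 2 * Q * (1 + 2 * h) / M * (∑ e ∈ Ioc 4 (2 * Q), (e : ℝ)⁻¹)
      ≤ 2 * Q * (1 + 2 * h) / M * (η * (2 * Q : ℕ) + 1 / η) := by
    gcongr; exact sum_Ioc_inv_le hη0 _
  have h3 : (2 * (2 * Q - 4 : ℕ) : ℝ) ≤ 4 * Q := by
    have : 2 * (2 * Q - 4) ≤ 4 * Q := by omega
    exact_mod_cast this
  rw [hsum]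
  have e2 : 2 * Q * (1 + 2 * h) / M * (η * (2 * Q : ℕ) + 1 / η)
      = h * Q ^ 2 / (4 * M ^ 2) + Q * (2 * (1 + 2 * h) * (1 / η) / M) := by
    have : (1 + 2 * h) * η = h / (16 * M) := by rw [hη]; field_simp
    have e : 2 * Q * (1 + 2 * h) / M * (η * (2 * Q : ℕ)) = h * Q ^ 2 / (4 * M ^ 2) := by
      push_cast
      calc _ = 4 * Q ^ 2 / M * ((1 + 2 * h) * η) := by ring
        _ = _ := by rw [this]; field_simp; ring
    rw [mul_add, e]; ring
  have e3 : ((Q : ℝ) / M - 1) * (2 * h * Q / M - 2) =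
      2 * h * Q ^ 2 / M ^ 2 - Q * ((2 + 2 * h) / M) + 2 := by
    field_simp; ring
  have h4 : Q * C ≤ h / (4 * (M : ℝ) ^ 2) * Q ^ 2 := by nlinarith
  have e4 : 2 * h * Q ^ 2 / (M : ℝ) ^ 2 = 8 * (h / (4 * (M : ℝ) ^ 2) * Q ^ 2) := by field_simp; ring
  have e5 : 4 * h * Q ^ 2 / (M : ℝ) ^ 2 * (1 / 4) = 4 * (h / (4 * (M : ℝ) ^ 2) * Q ^ 2) := by
    field_simp
  have e6 : h * Q ^ 2 / (4 * (M : ℝ) ^ 2) = h / (4 * (M : ℝ) ^ 2) * Q ^ 2 := by ring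
  have e7 : 1 / (2 * (M : ℝ) ^ 2) * h * (Q : ℝ) ^ 2 = 2 * (h / (4 * (M : ℝ) ^ 2) * Q ^ 2) := by
    field_simp; ring
  have h0 : 0 ≤ h / (4 * (M : ℝ) ^ 2) * Q ^ 2 := by positivity
  rw [e7, e3, e4]
  rw [e5] at h1
  rw [e2, e6] at h2
  rw [hC] at h4
  linarith

/-! ### Coprime representatives and dyadic families of fractions -/

/-- After division by `gcd(a, r)` the class of `r` becomes invertible, so Dirichlet gives
arbitrarily large primes `v` with `gcd(a, r) v ≡ r` modulo `a`; likewise `gcd(b, s) u ≡ s` modulo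
`b`. The two gcds are coprime by hypothesis, and large distinct primes add no common factor. -/
theorem exists_isCoprime_modEq {a b r s : ℤ} (ha : 0 < a) (hb : 0 < b)
    (hgcd : Nat.gcd (Int.gcd a b) (Int.gcd r s) = 1) :
    ∃ p q : ℤ, p ≡ r [ZMOD a] ∧ q ≡ s [ZMOD b] ∧ IsCoprime p q := by
  have key : ∀ a r : ℤ, 0 < a → ∀ N : ℕ, ∃ ℓ > N, ℓ.Prime ∧
      (Int.gcd a r : ℤ) * ℓ ≡ r [ZMOD a] := by
    intro a r ha N
    have hg : 0 < Int.gcd a r := Int.gcd_pos_of_ne_zero_left _ ha.ne'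
    obtain ⟨a', r', hcop, e1, e2⟩ := Int.exists_gcd_one hg
    have hgz : (0 : ℤ) < Int.gcd a r := by exact_mod_cast hg
    have ha' : 0 < a' := by
      rw [e1] at ha
      exact pos_of_mul_pos_left ha hgz.le
    have hna : (a'.natAbs : ℤ) = a' := Int.natAbs_of_nonneg ha'.le
    obtain ⟨ℓ, hℓN, hℓ, hmod⟩ := Nat.forall_exists_prime_gt_and_zmodEq N (q := a'.natAbs)
      (a := r') (by omega) (by
        rw [hna]; exact (Int.isCoprime_iff_gcd_eq_one.2 hcop).symm)
    refine ⟨ℓ, hℓN, hℓ, ?_⟩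
    rw [hna] at hmod
    have := hmod.mul_left' (c := (Int.gcd a r : ℤ))
    rw [mul_comm _ a', ← e1, mul_comm _ r', ← e2] at this
    exact this
  set g := Int.gcd b s with hg
  set h := Int.gcd a r with hh
  have hg0 : 0 < g := Int.gcd_pos_of_ne_zero_left _ hb.ne'
  have hh0 : 0 < h := Int.gcd_pos_of_ne_zero_left _ ha.ne'
  obtain ⟨u, hu, hup, hmu⟩ := key b s hb h
  obtain ⟨v, hv, hvp, hmv⟩ := key a r ha (max g u)
  refine ⟨(h : ℤ) * v, (g : ℤ) * u, hmv, hmu, ?_⟩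
  have c1 : Nat.Coprime h g := by
    refine Nat.dvd_one.1 ?_
    rw [← hgcd]
    have d1 : ((h.gcd g : ℕ) : ℤ) ∣ h := by exact_mod_cast Nat.gcd_dvd_left h g
    have d2 : ((h.gcd g : ℕ) : ℤ) ∣ g := by exact_mod_cast Nat.gcd_dvd_right h g
    refine Nat.dvd_gcd (Int.dvd_gcd ?_ ?_) (Int.dvd_gcd ?_ ?_)
    · exact d1.trans (Int.gcd_dvd_left ..)
    · exact d2.trans (Int.gcd_dvd_left ..)
    · exact d1.trans (Int.gcd_dvd_right ..)
    · exact d2.trans (Int.gcd_dvd_right ..)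
  have c2 : Nat.Coprime h u :=
    ((Nat.Prime.coprime_iff_not_dvd hup).2 fun hd => absurd (Nat.le_of_dvd hh0 hd) (by omega)).symm
  have c3 : Nat.Coprime v g :=
    (Nat.Prime.coprime_iff_not_dvd hvp).2 fun hd =>
      absurd (Nat.le_of_dvd hg0 hd) (by have := le_max_left g u; omega)
  have c4 : Nat.Coprime v u :=
    (Nat.coprime_primes hvp hup).2 (by have := le_max_right g u; omega)
  have : Nat.Coprime (h * v) (g * u) :=
    Nat.Coprime.mul_left (Nat.Coprime.mul_right c1 c2) (Nat.Coprime.mul_right c3 c4)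
  exact_mod_cast Nat.isCoprime_iff_coprime.2 this

/-- The reduced fractions `p / q` with `2 ^ k < q ≤ 2 ^ (k + 1)` whose numerator and denominator lie
in prescribed residue classes. -/
def dyadicFractions (M : ℕ) (p₀ q₀ : ℤ) (k : ℕ) : Set ℝ :=
  {x | ∃ p q : ℤ, (2 ^ k < q ∧ q ≤ 2 ^ (k + 1)) ∧ p ≡ p₀ [ZMOD M] ∧ q ≡ q₀ [ZMOD M] ∧
    IsCoprime p q ∧ x = (p : ℝ) / q}

/-- Distinct fractions differ by at least `1 / (q q')`, and both denominators are at most `2^(k+1)`.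
-/
theorem dyadicFractions_separated (M : ℕ) (p₀ q₀ : ℤ) (k : ℕ) :
    ∀ x ∈ dyadicFractions M p₀ q₀ k, ∀ y ∈ dyadicFractions M p₀ q₀ k, x ≠ y →
      1 / (4 * 4 ^ k) ≤ |x - y| := by
  rintro x ⟨p, q, ⟨hq1, hq2⟩, -, -, -, rfl⟩ y ⟨p', q', ⟨hq1', hq2'⟩, -, -, -, rfl⟩ hxy
  have h2 : (0 : ℝ) < 2 ^ k := by positivity
  have hq : (0 : ℝ) < q := h2.trans (by exact_mod_cast hq1)
  have hq' : (0 : ℝ) < q' := h2.trans (by exact_mod_cast hq1')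
  have hqle : (q : ℝ) ≤ 2 ^ (k + 1) := by exact_mod_cast hq2
  have hqle' : (q' : ℝ) ≤ 2 ^ (k + 1) := by exact_mod_cast hq2'
  have e : (p : ℝ) / q - p' / q' = ((p * q' - q * p' : ℤ) : ℝ) / (q * q') := by
    push_cast
    exact div_sub_div _ _ hq.ne' hq'.ne'
  have hne : p * q' - q * p' ≠ 0 := fun h0 => hxy (sub_eq_zero.1 (by rw [e, h0]; simp))
  have h1 : (1 : ℝ) ≤ |((p * q' - q * p' : ℤ) : ℝ)| := by
    exact_mod_cast Int.one_le_abs hne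
  rw [e, abs_div, abs_of_pos (mul_pos hq hq')]
  have h4 : (4 : ℝ) * 4 ^ k = 2 ^ (k + 1) * 2 ^ (k + 1) := by
    rw [← mul_pow, pow_succ]; norm_num [mul_comm]
  rw [h4]
  gcongr

open Finset Filter in
theorem eventually_exists_subset_dyadicFractions {M : ℕ} (h6 : 6 ∣ M) (hM : 0 < M) {p₀ q₀ : ℤ}
    (hcop : IsCoprime p₀ q₀) (z h : ℝ) (hh : 0 < h) :
    ∀ᶠ k in atTop, ∃ P : Finset ℝ, (∀ x ∈ P, x ∈ dyadicFractions M p₀ q₀ k ∧ |x - z| ≤ h) ∧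
      1 / (2 * (M : ℝ) ^ 2) * h * 4 ^ k ≤ P.card := by
  classical
  have hpow : Tendsto (fun k : ℕ => 2 ^ k) atTop atTop := tendsto_pow_atTop_atTop_of_one_lt one_lt_two
  have hQh : ∀ᶠ Q : ℕ in atTop, (M : ℝ) ≤ Q * h :=
    (tendsto_natCast_atTop_atTop.atTop_mul_const hh).eventually_ge_atTop _
  have hev := hpow.eventually ((le_sub_sum_Ioc hM hh).and (hQh.and (eventually_ge_atTop M)))
  filter_upwards [hev] with k hk
  obtain ⟨h1, h2, h3⟩ := hk
  have hG := h1.trans (card_coprime_modEq_ge (z := z) h6 hM (by positivity) hcop hh h2 h3)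
  set G := {x ∈ ({q ∈ Ioc ((2 ^ k : ℕ) : ℤ) (2 * (2 ^ k : ℕ)) | q ≡ q₀ [ZMOD M]}).sigma
    (fun q => {p ∈ Ioc ⌊(q : ℝ) * (z - h)⌋ ⌊(q : ℝ) * (z + h)⌋ | p ≡ p₀ [ZMOD M]}) |
      IsCoprime x.2 x.1}
  have hmem : ∀ x ∈ G, ((2 ^ k < x.1 ∧ x.1 ≤ 2 ^ (k + 1)) ∧ x.1 ≡ q₀ [ZMOD M]) ∧
      ((⌊(x.1 : ℝ) * (z - h)⌋ < x.2 ∧ x.2 ≤ ⌊(x.1 : ℝ) * (z + h)⌋) ∧ x.2 ≡ p₀ [ZMOD M]) ∧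
      IsCoprime x.2 x.1 := by
    intro x hx
    obtain ⟨hx1, hx2⟩ := mem_filter.1 hx
    obtain ⟨hx3, hx4⟩ := mem_sigma.1 hx1
    simp only [mem_filter, mem_Ioc] at hx3 hx4
    push_cast at hx3
    rw [pow_succ, mul_comm _ (2 : ℤ)]
    exact ⟨hx3, hx4, hx2⟩
  have hpos : ∀ x ∈ G, 0 < x.1 := fun x hx =>
    lt_trans (by positivity) (hmem x hx).1.1.1
  refine ⟨G.image fun x => (x.2 : ℝ) / x.1, ?_, ?_⟩
  · intro y hy
    obtain ⟨x, hx, rfl⟩ := mem_image.1 hy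
    obtain ⟨m1, m2, m3⟩ := hmem x hx
    refine ⟨⟨x.2, x.1, m1.1, m2.2, m1.2, m3, rfl⟩, ?_⟩
    have hq : (0 : ℝ) < x.1 := by exact_mod_cast hpos x hx
    have l1 := Int.floor_lt.1 m2.1.1
    have l2 := Int.le_floor.1 m2.1.2
    rw [abs_le]
    constructor
    · rw [neg_le_sub_iff_le_add, ← sub_le_iff_le_add, le_div_iff₀ hq]
      linarith
    · rw [sub_le_iff_le_add, div_le_iff₀ hq]
      linarith
  · rw [card_image_of_injOn]
    · refine le_trans (le_of_eq ?_) hG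
      push_cast
      rw [← pow_mul, mul_comm k 2, pow_mul]
      norm_num
    -- A reduced fraction with positive denominator determines its pair, so counting pairs counts
    -- points.
    · rintro ⟨q, p⟩ hx ⟨q', p'⟩ hx' hxx
      have hq := hpos _ hx
      have hq' := hpos _ hx'
      have c := (hmem _ hx).2.2
      have c' := (hmem _ hx').2.2
      dsimp only at hq hq' c c' hxx
      have hqr : (q : ℝ) ≠ 0 := by exact_mod_cast hq.ne'
      have hqr' : (q' : ℝ) ≠ 0 := by exact_mod_cast hq'.ne'
      rw [div_eq_div_iff hqr hqr'] at hxx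
      have hz : p * q' = p' * q := by exact_mod_cast hxx
      have d1 : q ∣ q' := c.symm.dvd_of_dvd_mul_left ⟨p', by rw [hz, mul_comm]⟩
      have d2 : q' ∣ q := c'.symm.dvd_of_dvd_mul_left ⟨p, by rw [← hz, mul_comm]⟩
      have e : q = q' := Int.dvd_antisymm hq.le hq'.le d1 d2
      subst e
      rw [mul_right_cancel₀ hq.ne' hz]

/-! ### Condensation and truncation of the divergent series -/

/-- Cauchy condensation: for `2^K ≤ n < 2^(K+1)` one has `b n + s ≥ d 2^K`, so the block sums to at
most `2 * 4^K * Ψ (d 2^K)`. Sampling at `2^(k+1)` serves the later use, where `Ψ` must be bounded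
below on the whole block; the shift costs a constant factor. -/
theorem not_summable_condensed {Ψ : ℝ → ℝ} (hpos : ∀ x ∈ Set.Ici (1 : ℝ), 0 < Ψ x)
    (hmono : AntitoneOn Ψ (Set.Ici 1)) {b s d : ℝ} (hd : 1 ≤ d) (hdb : d ≤ b) (hs : 0 ≤ s)
    (hdiv : ¬ Summable (fun n : ℕ => ((n + 1 : ℕ) : ℝ) * Ψ (b * ((n + 1 : ℕ) : ℝ) + s))) :
    ¬ Summable fun k : ℕ => 4 ^ k * Ψ (d * 2 ^ (k + 1)) := by
  intro hsum
  have hone : ∀ k : ℕ, d * 2 ^ k ∈ Set.Ici (1 : ℝ) := fun k =>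
    one_le_mul_of_one_le_of_one_le hd (one_le_pow₀ one_le_two)
  have hsum' : Summable fun k : ℕ => 2 * 4 ^ k * Ψ (d * 2 ^ k) := by
    rw [← summable_nat_add_iff 1]
    refine (hsum.mul_left 8).congr fun k => ?_
    rw [pow_succ 4 k]; ring
  set g : ℕ → ℝ := fun n => (n : ℝ) * Ψ (b * n + s) with hg
  have hin : ∀ n : ℕ, 1 ≤ n → b * n + s ∈ Set.Ici (1 : ℝ) := fun n hn => by
    have : (1 : ℝ) ≤ n := by exact_mod_cast hn
    simp only [Set.mem_Ici]; nlinarith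
  have hg0 : ∀ n, 0 ≤ g n := fun n => by
    rcases Nat.eq_zero_or_pos n with rfl | hn
    · simp [hg]
    · exact mul_nonneg (by positivity) (hpos _ (hin n hn)).le
  refine hdiv ((summable_nat_add_iff (f := g) 1).2 ?_)
  have hblock : ∀ K : ℕ, ∑ n ∈ Finset.range (2 ^ K), g n ≤
      ∑ k ∈ Finset.range K, 2 * 4 ^ k * Ψ (d * 2 ^ k) := by
    intro K
    induction K with
    | zero => simp [hg]
    | succ K ih =>
      rw [Finset.sum_range_succ, ← Finset.sum_range_add_sum_Ico g
        (Nat.pow_le_pow_right two_pos K.le_succ)]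
      refine add_le_add ih ?_
      have hterm : ∀ n ∈ Finset.Ico (2 ^ K) (2 ^ (K + 1)), g n ≤ 2 ^ (K + 1) * Ψ (d * 2 ^ K) := by
        intro n hn
        obtain ⟨h1, h2⟩ := Finset.mem_Ico.1 hn
        have h1' : (2 : ℝ) ^ K ≤ n := by exact_mod_cast h1
        have h2' : (n : ℝ) ≤ 2 ^ (K + 1) := by exact_mod_cast h2.le
        have hn1 : 1 ≤ n := le_trans Nat.one_le_two_pow h1
        refine mul_le_mul h2' (hmono (hone K) (hin n hn1) ?_) (hpos _ (hin n hn1)).le (by positivity)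
        nlinarith
      refine (Finset.sum_le_card_nsmul _ _ _ hterm).trans (le_of_eq ?_)
      have hcard : 2 ^ (K + 1) - 2 ^ K = 2 ^ K := by rw [pow_succ]; omega
      rw [Nat.card_Ico, hcard, nsmul_eq_mul]
      push_cast
      have : (4 : ℝ) ^ K = 2 ^ K * 2 ^ K := by rw [← mul_pow]; norm_num
      rw [this, pow_succ]; ring
  refine summable_of_sum_range_le hg0 (c := ∑' k : ℕ, 2 * 4 ^ k * Ψ (d * 2 ^ k)) fun n => ?_
  refine (Finset.sum_le_sum_of_subset_of_nonneg (Finset.range_mono Nat.lt_two_pow_self.le)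
    fun _ _ _ => hg0 _).trans ((hblock n).trans (hsum'.sum_le_tsum _ fun k _ => ?_))
  have := hpos _ (hone k)
  positivity

/-- Wherever the cap is the minimum, the term equals `1 / 8`; a summable series allows this only
finitely often, so its tail is that of the original series. -/
theorem not_summable_mul_min {f : ℕ → ℝ} (hf : ¬ Summable fun k => 4 ^ k * f k) :
    ¬ Summable fun k => 4 ^ k * min (f k) (1 / (8 * 4 ^ k)) := by
  intro hs
  have hlt : ∀ᶠ k in Filter.atTop, 4 ^ k * min (f k) (1 / (8 * 4 ^ k)) < 1 / 8 :=
    hs.tendsto_atTop_zero.eventually_lt_const (by norm_num)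
  obtain ⟨N, hN⟩ := Filter.eventually_atTop.1 hlt
  refine hf ((summable_nat_add_iff N).1 (((summable_nat_add_iff N).2 hs).congr fun k => ?_))
  have hk := hN (k + N) (by omega)
  rcases min_choice (f (k + N)) (1 / (8 * 4 ^ (k + N))) with h | h
  · rw [h]
  · rw [h] at hk
    refine absurd hk (not_lt.2 (le_of_eq ?_))
    field_simp

/-! ### The divergence case -/

theorem volume_compl_approxSetGcd_eq_zero {a b r s : ℤ} (ha : 1 ≤ a) (hb : 1 ≤ b) (hs₀ : 0 ≤ s)
    {Ψ : ℝ → ℝ} (hpos : ∀ x ∈ Set.Ici (1 : ℝ), 0 < Ψ x) (hmono : AntitoneOn Ψ (Set.Ici 1))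
    (hdiv : ¬ Summable
      (fun n : ℕ => ((n + 1 : ℕ) : ℝ) * Ψ ((b : ℝ) * ((n + 1 : ℕ) : ℝ) + (s : ℝ)))) :
    volume (approxSetGcd a b r s Ψ)ᶜ = 0 := by
  set d := Nat.gcd (Int.gcd a b) (Int.gcd r s) with hd
  have hd0 : 0 < d := Nat.gcd_pos_of_pos_left _ (Int.gcd_pos_of_ne_zero_left _ (by omega))
  have hdz : (0 : ℤ) < d := by exact_mod_cast hd0
  have hd1 : (d : ℤ) ∣ (Int.gcd a b : ℤ) := by exact_mod_cast Nat.gcd_dvd_left _ _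
  have hd2 : (d : ℤ) ∣ (Int.gcd r s : ℤ) := by exact_mod_cast Nat.gcd_dvd_right _ _
  obtain ⟨a', ea⟩ := hd1.trans (Int.gcd_dvd_left ..)
  obtain ⟨b', eb⟩ := hd1.trans (Int.gcd_dvd_right ..)
  obtain ⟨r', er⟩ := hd2.trans (Int.gcd_dvd_left ..)
  obtain ⟨s', es⟩ := hd2.trans (Int.gcd_dvd_right ..)
  have ha' : 0 < a' := pos_of_mul_pos_right (by rw [← ea]; omega) hdz.le
  have hb' : 0 < b' := pos_of_mul_pos_right (by rw [← eb]; omega) hdz.le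
  have hgcd : Nat.gcd (Int.gcd a' b') (Int.gcd r' s') = 1 := by
    have h := hd
    rw [ea, eb, er, es, Int.gcd_mul_left, Int.gcd_mul_left, Int.natAbs_natCast,
      Nat.gcd_mul_left] at h
    exact (Nat.mul_right_cancel hd0 (by rw [one_mul]; rw [mul_comm]; exact h.symm))
  obtain ⟨p₀, q₀, hp₀, hq₀, hcop⟩ := exists_isCoprime_modEq ha' hb' hgcd
  -- A class modulo `M` determines the classes modulo `a'` and `b'`; the factor 6 is for the sieve.
  set M : ℕ := 6 * (a'.natAbs * b'.natAbs) with hM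
  have hM0 : 0 < M := by
    have : 0 < a'.natAbs := by omega
    have : 0 < b'.natAbs := by omega
    positivity
  have haM : a' ∣ (M : ℤ) := by
    rw [← Int.natAbs_dvd_natAbs, Int.natAbs_natCast]
    exact ⟨6 * b'.natAbs, by rw [hM]; ring⟩
  have hbM : b' ∣ (M : ℤ) := by
    rw [← Int.natAbs_dvd_natAbs, Int.natAbs_natCast]
    exact ⟨6 * a'.natAbs, by rw [hM]; ring⟩
  have hdr : (1 : ℝ) ≤ d := by exact_mod_cast hd0
  have hdb : (d : ℝ) ≤ b := by
    have : (d : ℤ) ≤ b := Int.le_of_dvd (by omega) ⟨b', eb⟩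
    exact_mod_cast this
  set ψ : ℕ → ℝ := fun k => min (Ψ (d * 2 ^ (k + 1))) (1 / (8 * 4 ^ k)) with hψ
  have hone : ∀ k : ℕ, (d : ℝ) * 2 ^ k ∈ Set.Ici (1 : ℝ) := fun k =>
    one_le_mul_of_one_le_of_one_le hdr (one_le_pow₀ one_le_two)
  have hae := ae_frequently_exists_dist_lt (ψ := ψ) (X := dyadicFractions M p₀ q₀)
    (c := 1 / (2 * (M : ℝ) ^ 2)) (by positivity)
    (fun k => lt_min (hpos _ (hone _)) (by positivity)) (fun k => min_le_right _ _)
    (not_summable_mul_min (not_summable_condensed hpos hmono hdr hdb (by exact_mod_cast hs₀) hdiv))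
    (dyadicFractions_separated M p₀ q₀)
    (eventually_exists_subset_dyadicFractions ⟨_, hM⟩ hM0 hcop)
  refine measure_mono_null (Set.compl_subset_compl.2 fun ξ hξ => ?_) hae
  intro hfin
  -- Finitely many solutions would bound the reduced denominators by `B`, but a scale `k ≥ B`
  -- produces one exceeding `2^k > k`.
  obtain ⟨B, hB⟩ := (hfin.image fun p : ℤ × ℤ => b' * p.2 + s').bddAbove
  obtain ⟨k, hk, x, ⟨p, q, hq, hp1, hq1, hpq, rfl⟩, hdist⟩ :=
    Filter.frequently_atTop.1 hξ B.toNat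
  obtain ⟨m, hm⟩ := ((hp1.of_dvd haM).trans hp₀).symm.dvd
  obtain ⟨n, hn⟩ := ((hq1.of_dvd hbM).trans hq₀).symm.dvd
  have hp' : p = a' * m + r' := by omega
  have hq' : q = b' * n + s' := by omega
  have eP : a * m + r = d * p := by rw [hp', ea, er]; ring
  have eQ : b * n + s = d * q := by rw [hq', eb, es]; ring
  have hqpos : 0 < q := lt_trans (by positivity) hq.1
  have hqr : (0 : ℝ) < q := by exact_mod_cast hqpos
  have hmem : q ≤ B := by
    refine hB ⟨(m, n), ⟨?_, ?_, ?_⟩, hq'.symm⟩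
    · change 1 ≤ b * n + s
      rw [eQ]; exact Int.add_one_le_of_lt (mul_pos hdz hqpos)
    · change |ξ - ((a * m + r : ℤ) : ℝ) / ((b * n + s : ℤ) : ℝ)| < Ψ ((b * n + s : ℤ) : ℝ)
      rw [eP, eQ]
      push_cast
      rw [mul_div_mul_left _ _ (by positivity), ← Real.dist_eq]
      refine hdist.trans_le ((min_le_left _ _).trans (hmono ?_ (hone _) ?_))
      · exact one_le_mul_of_one_le_of_one_le hdr (by exact_mod_cast hqpos)
      · have : (q : ℝ) ≤ 2 ^ (k + 1) := by exact_mod_cast hq.2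
        gcongr
    · change Int.gcd (a * m + r) (b * n + s) = d
      rw [eP, eQ, Int.gcd_mul_left, Int.isCoprime_iff_gcd_eq_one.1 hpq]; simp
  have : (k : ℤ) < 2 ^ k := by exact_mod_cast Nat.lt_two_pow_self
  have := hq.1
  omega

/-! ### The convergence case and the conclusion -/

theorem volume_approxSet_eq_zero {a b r s : ℤ} (ha : 1 ≤ a) (hb : 1 ≤ b) (hr₀ : 0 ≤ r)
    (hr₁ : r ≤ a - 1) (hs₀ : 0 ≤ s) (hs₁ : s ≤ b - 1)
    {Ψ : ℝ → ℝ} (hpos : ∀ x ∈ Set.Ici (1 : ℝ), 0 < Ψ x) (hmono : AntitoneOn Ψ (Set.Ici 1))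
    (hsum : Summable
      (fun n : ℕ => ((n + 1 : ℕ) : ℝ) * Ψ ((b : ℝ) * ((n + 1 : ℕ) : ℝ) + (s : ℝ)))) :
    volume (approxSet a b r s Ψ) = 0 := by
  have hΨ1 := hpos 1 (Set.mem_Ici.2 le_rfl)
  set q : ℕ → ℤ := fun n => b * (n + 1 : ℕ) + s with hq
  have hq1 : ∀ n, 1 ≤ q n := fun n => by
    simp only [hq]; push_cast; nlinarith
  have hq1r : ∀ n, (1 : ℝ) ≤ q n := fun n => by exact_mod_cast hq1 n
  have hmb : ∀ (m Y : ℤ), |a * m + r| ≤ Y → m ∈ Finset.Icc (-(Y + 1)) (Y + 1) := by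
    intro m Y h
    obtain ⟨h1, h2⟩ := abs_le.1 h
    rw [Finset.mem_Icc]
    constructor <;> nlinarith
  have hlocal : ∀ R : ℕ, ∀ᵐ ξ : ℝ, |ξ| ≤ R → ξ ∉ approxSet a b r s Ψ := by
    intro R
    set T : ℝ → ℤ := fun x => ⌈(R + Ψ 1) * x⌉ + 1 with hT
    have hnum : ∀ (ξ : ℝ) (m Q : ℤ), |ξ| ≤ R → 1 ≤ Q →
        |ξ - ((a * m + r : ℤ) : ℝ) / (Q : ℝ)| < Ψ Q → m ∈ Finset.Icc (-T Q) (T Q) := by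
      intro ξ m Q hξ hQ h
      have hQr : (1 : ℝ) ≤ Q := by exact_mod_cast hQ
      refine hmb m _ ?_
      have h1 : Ψ Q ≤ Ψ 1 := hmono (Set.mem_Ici.2 le_rfl) hQr hQr
      have h2 : |((a * m + r : ℤ) : ℝ) / (Q : ℝ)| ≤ R + Ψ 1 := by
        have := abs_sub_abs_le_abs_sub (((a * m + r : ℤ) : ℝ) / (Q : ℝ)) ξ
        rw [abs_sub_comm] at this
        linarith
      rw [abs_div, abs_of_pos (by linarith : (0 : ℝ) < Q), div_le_iff₀ (by linarith)] at h2
      have h3 := h2.trans (Int.le_ceil _)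
      exact_mod_cast h3
    set A : ℕ → Set ℝ := fun n => ⋃ m ∈ Finset.Icc (-T (q n)) (T (q n)),
      Metric.ball (((a * m + r : ℤ) : ℝ) / (q n : ℝ)) (Ψ (q n)) with hA
    -- There are `2 T + 1 ≤ (2 (R + Ψ 1) + 5) q` numerators, each interval has length `2 Ψ(q)`, and
    -- `q ≤ 2 b (n + 1)`.
    set C : ℝ := 2 * (2 * (R + Ψ 1) + 5) * (2 * b) with hC
    have hvol : ∀ n : ℕ, volume (A n) ≤
        ENNReal.ofReal (C * (((n + 1 : ℕ) : ℝ) * Ψ ((b : ℝ) * ((n + 1 : ℕ) : ℝ) + (s : ℝ)))) := by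
      intro n
      have hΨq := hpos _ (hq1r n)
      have eq : ((q n : ℤ) : ℝ) = (b : ℝ) * ((n + 1 : ℕ) : ℝ) + (s : ℝ) := by
        simp [hq]
      rw [← eq]
      refine (measure_biUnion_finset_le _ _).trans ?_
      simp only [Real.volume_ball, Finset.sum_const, nsmul_eq_mul, Int.card_Icc]
      rw [← ENNReal.ofReal_natCast, ← ENNReal.ofReal_mul (by positivity)]
      refine ENNReal.ofReal_le_ofReal ?_
      have hT0 : 0 ≤ T (q n) := by
        have : 0 ≤ ⌈((R : ℝ) + Ψ 1) * q n⌉ := Int.ceil_nonneg (by have := hq1r n; positivity)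
        simp only [hT]; omega
      have hc : (((T (q n) + 1 - -T (q n)).toNat : ℕ) : ℝ) = 2 * T (q n) + 1 := by
        have : (((T (q n) + 1 - -T (q n)).toNat : ℕ) : ℤ) = 2 * T (q n) + 1 := by omega
        exact_mod_cast this
      have hTle : (T (q n) : ℝ) ≤ (R + Ψ 1) * q n + 2 := by
        have := Int.ceil_lt_add_one (((R : ℝ) + Ψ 1) * q n)
        simp only [hT]; push_cast; linarith
      have hqle : (q n : ℝ) ≤ 2 * b * ((n + 1 : ℕ) : ℝ) := by
        have : q n ≤ 2 * b * ((n + 1 : ℕ) : ℤ) := by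
          simp only [hq]; push_cast; nlinarith
        exact_mod_cast this
      rw [hc]
      have hq1n := hq1r n
      have hR : (0 : ℝ) ≤ R := by positivity
      calc (2 * (T (q n) : ℝ) + 1) * (2 * Ψ (q n))
          ≤ ((2 * (R + Ψ 1) + 5) * q n) * (2 * Ψ (q n)) := by
            gcongr; linarith
        _ ≤ ((2 * (R + Ψ 1) + 5) * (2 * b * ((n + 1 : ℕ) : ℝ))) * (2 * Ψ (q n)) := by
            gcongr
        _ = _ := by rw [hC]; ring
    have htop : ∑' n, volume (A n) ≠ ⊤ :=
      ne_top_of_le_ne_top (hsum.mul_left C).tsum_ofReal_ne_top (ENNReal.tsum_le_tsum hvol)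
    filter_upwards [ae_eventually_notMem htop] with ξ hξ hR
    obtain ⟨N, hN⟩ := Filter.eventually_atTop.1 hξ
    intro hinf
    refine hinf ?_
    -- `A j` belongs to the index `n = j + 1`, so Borel–Cantelli excludes `n > N`. Negative `n`
    -- violate `1 ≤ b n + s`; the rest, including `n = 0`, gives finitely many pairs.
    refine ((Finset.Icc (0 : ℤ) N).finite_toSet.biUnion fun n _ =>
      ((Finset.Icc (-T ((b * n + s : ℤ) : ℝ)) (T ((b * n + s : ℤ) : ℝ))).finite_toSet.image
        fun m => (m, n))).subset ?_
    rintro ⟨m, n⟩ ⟨h1, h2⟩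
    change 1 ≤ b * n + s at h1
    have hn0 : 0 ≤ n := by
      by_contra! hneg
      nlinarith
    have hm := hnum ξ m (b * n + s) hR h1 h2
    simp only [Set.mem_iUnion]
    refine ⟨n, ?_, m, hm, rfl⟩
    rw [Finset.mem_coe, Finset.mem_Icc]
    refine ⟨hn0, ?_⟩
    by_contra! hgt
    obtain ⟨j, rfl⟩ : ∃ j : ℕ, n = ((j + 1 : ℕ) : ℤ) := ⟨(n - 1).toNat, by omega⟩
    refine hN j (by omega) ?_
    simp only [hA, Set.mem_iUnion]
    exact ⟨m, hm, by rw [Metric.mem_ball, Real.dist_eq]; exact h2⟩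
  have hall : ∀ᵐ ξ : ℝ, ξ ∉ approxSet a b r s Ψ := by
    filter_upwards [ae_all_iff.2 hlocal] with ξ hξ
    exact hξ ⌈|ξ|⌉₊ (Nat.le_ceil _)
  exact measure_eq_zero_iff_ae_notMem.2 hall

theorem approxSetGcd_subset_approxSet (a b r s : ℤ) (Ψ : ℝ → ℝ) :
    approxSetGcd a b r s Ψ ⊆ approxSet a b r s Ψ :=
  fun _ h => h.mono fun _ hp => ⟨hp.1, hp.2.1⟩

theorem mainTheorem3 (a b r s : ℤ) (ha : 1 ≤ a) (hb : 1 ≤ b)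
    (hr₀ : 0 ≤ r) (hr₁ : r ≤ a - 1) (hs₀ : 0 ≤ s) (hs₁ : s ≤ b - 1)
    (Ψ : ℝ → ℝ) (hpos : ∀ x ∈ Set.Ici (1 : ℝ), 0 < Ψ x)
    (hmono : AntitoneOn Ψ (Set.Ici 1)) (hcont : ContinuousOn Ψ (Set.Ici 1)) :
    (Summable (fun n : ℕ => ((n + 1 : ℕ) : ℝ) * Ψ ((b : ℝ) * ((n + 1 : ℕ) : ℝ) + (s : ℝ))) →
      volume (approxSet a b r s Ψ) = 0 ∧ volume (approxSetGcd a b r s Ψ) = 0) ∧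
    (¬ Summable (fun n : ℕ => ((n + 1 : ℕ) : ℝ) * Ψ ((b : ℝ) * ((n + 1 : ℕ) : ℝ) + (s : ℝ))) →
      volume (approxSet a b r s Ψ)ᶜ = 0 ∧ volume (approxSetGcd a b r s Ψ)ᶜ = 0) := by
  refine ⟨fun hsum => ?_, fun hdiv => ?_⟩
  · have h := volume_approxSet_eq_zero ha hb hr₀ hr₁ hs₀ hs₁ hpos hmono hsum
    exact ⟨h, measure_mono_null (approxSetGcd_subset_approxSet a b r s Ψ) h⟩
  · have h := volume_compl_approxSetGcd_eq_zero (r := r) ha hb hs₀ hpos hmono hdiv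
    exact ⟨measure_mono_null (Set.compl_subset_compl.2 (approxSetGcd_subset_approxSet a b r s Ψ)) h,
      h⟩
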